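/- Let $I\in\mathbb N$ be the number of customer types. Let $\bar{\mathcal K}\subset\mathbb Z_+^I$ be a finite set of feasible server configurations that is monotone ($k\in\bar{\mathcal K}$, $k'\in\mathbb Z_+^I$, $k'\le k$ componentwise imply $k'\in\bar{\mathcal K}$) and contains every unit vector $e_i$, and put $\mathcal K=\bar{\mathcal K}\setminus\{0\}$. Let $\rho_i\ge 0$ with $\sum_i\rho_i=1$, let $\mu_i>0$, and let $p\in(\tfrac12,1)$. *Linear program.* Let $\mathcal X=\{x\in\mathbb R_+^{\mathcal K}:\sum_{k\in\mathcal K}k_ix_k=\rho_i\text{ for all }i\}$, let $\mathcal X^*$ be the set of minimizers of $\sum_{k\in\mathcal K}x_k$ over $\mathcal X$, and let $d(x,\mathcal X^*)=\inf_{u\in\mathcal X^*}\sum_{k\in\mathcal K}|x_k-u_k|$. *Closed system.* For $r\in\mathbb N$ such that all $\rho_ir$ are integers, the closed system contains exactly $\rho_ir$ customers of type $i$ at all times, distributed over an infinite supply of servers. Its state is $X=(X_k)_{k\in\mathcal K}$, where $X_k\in\mathbb Z_+$ is the number of servers in configuration $k$, so that $\sum_kk_iX_k=\rho_ir$ for all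 $i$; by convention $X_0=0$. Each type-$i$ customer, independently of the others and at rate $\mu_i$ (i.e. after exponential service requirements of mean $1/\mu_i$), leaves its server and is immediately placed again; thus a type-$i$ customer leaves a server in configuration $k$ at total rate $k_i\mu_iX_k$, which replaces that server by one in configuration $k-e_i$. *GSS policy.* Let $w^r(n)=\min\{1,n/r^p\}$. Given the counts $X$ after the departure, the type-$i$ customer is placed into a server in some configuration $k-e_i$ with $k\in\mathcal K$, $k_i\ge1$ (which thus becomes a server in configuration $k$), where $X_{k-e_i}>0$ or $k-e_i=0$, such that $w^r(X_k)-w^r(X_{k-e_i})$ is minimal among all such possibilities. Ties are broken by an arbitrary, possibly randomized, rule that depends only on the state before the departure, the configuration left and the type $i$. The state process is then a continuous-time Markov chain on a finite state space. Let $X^r(\infty)$ be a random state distributed according to any stationary distribution of this chain, and let $x^r(\infty)=X^r(\infty)/r$. **Theorem.** There is a constant $C>0$, not depending on $r$, nor on the tie-breaking rules or the choice of the stationary distributions, such that $$\mathbb P\bigl(d(x^r(\infty),\mathcal X^*)\le C\,r^{p-1}\bigr)\to1$$ as $r\to\infty$ along the integers $r$ for which all $\rho_ir$ are integers. Consequently,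 fluid-scale asymptotic optimality holds: $d(x^r(\infty),\mathcal X^*)\to0$ in distribution along the same $r$. -/

import Mathlib

open MeasureTheory Filter Topology

/-- The data of the closed system with `I` customer types: a finite monotone set of feasible server
configurations containing every unit vector, the fractions `ρ i` of customers of each type, and the
migration rates `μ i` (service requirements of type `i` are exponential with mean `1 / μ i`). -/
structure PackingModel (I : ℕ) where
  /-- The set of feasible server configurations, including the empty one. -/
  Kbar : Finset (Fin I → ℕ)
  monotone : ∀ k ∈ Kbar, ∀ k' : Fin I → ℕ, k' ≤ k → k' ∈ Kbar
  unit_mem : ∀ i, (Pi.single i 1 : Fin I → ℕ) ∈ Kbar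
  ρ : Fin I → ℝ
  ρ_nonneg : ∀ i, 0 ≤ ρ i
  ρ_sum : ∑ i, ρ i = 1
  μ : Fin I → ℝ
  μ_pos : ∀ i, 0 < μ i

noncomputable section

namespace PackingModel

variable {I : ℕ} (M : PackingModel I)

/-- The nonzero feasible configurations. -/
abbrev Config : Type := {k : Fin I → ℕ // k ∈ M.Kbar.erase 0}

/-! ### The linear program -/

/-- Real vectors indexed by nonzero configurations, with the `1`-norm. -/
abbrev FluidSpace : Type := PiLp 1 (fun _ : M.Config => ℝ)

/-- The feasible set of the linear program. -/
def lpFeasible : Set M.FluidSpace :=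
  {x | (∀ k, 0 ≤ x k) ∧ ∀ i, ∑ k : M.Config, (k.1 i : ℝ) * x k = M.ρ i}

/-- The set of optimal solutions: feasible points minimizing the sum of the coordinates. -/
def lpOptimal : Set M.FluidSpace :=
  {x | x ∈ M.lpFeasible ∧ ∀ y ∈ M.lpFeasible, ∑ k, x k ≤ ∑ k, y k}

/-! ### System states -/

/-- The system sizes `r` for which every `ρ i * r` is a whole number of customers. -/
abbrev Size : Type := {r : ℕ // ∀ i, ∃ n : ℕ, (n : ℝ) = M.ρ i * r}

/-- The states of the closed system with `r` customers: `X k` is the number of servers in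
configuration `k`, and there are `ρ i * r` customers of type `i`. -/
def State (r : ℕ) : Type :=
  {X : M.Config → ℕ // ∀ i, ∑ k : M.Config, (k.1 i : ℝ) * X k = M.ρ i * r}

instance (r : ℕ) : Finite (M.State r) := by
  have hfin : (Set.Iic (fun _ : M.Config => ⌈∑ i, M.ρ i * r⌉₊)).Finite := Set.finite_Iic _
  refine Set.Finite.subset hfin ?_
  intro X hX k
  have hX' : ∀ i, ∑ k : M.Config, (k.1 i : ℝ) * X k = M.ρ i * r := hX
  have hne : k.1 ≠ 0 := (Finset.mem_erase.mp k.2).1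
  obtain ⟨i, hi⟩ := Function.ne_iff.mp hne
  have h1 : (1 : ℝ) ≤ k.1 i := by
    exact_mod_cast Nat.one_le_iff_ne_zero.mpr hi
  have h2 : (k.1 i : ℝ) * X k ≤ M.ρ i * r := by
    rw [← hX' i]
    exact Finset.single_le_sum (f := fun l : M.Config => (l.1 i : ℝ) * X l)
      (fun l _ => by positivity) (Finset.mem_univ k)
  have h3 : M.ρ i * r ≤ ∑ j, M.ρ j * r :=
    Finset.single_le_sum (f := fun j => M.ρ j * (r : ℝ))
      (fun j _ => mul_nonneg (M.ρ_nonneg j) (Nat.cast_nonneg r)) (Finset.mem_univ i)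
  have h4 : (X k : ℝ) ≤ ∑ j, M.ρ j * r := by
    have : (0 : ℝ) ≤ X k := Nat.cast_nonneg _
    nlinarith
  exact_mod_cast h4.trans (Nat.le_ceil _)

instance (r : ℕ) : Fintype (M.State r) := Fintype.ofFinite _

instance (r : ℕ) : DecidableEq (M.State r) := Classical.decEq _

instance (r : ℕ) : MeasurableSpace (M.State r) := ⊤

/-- The fluid-scaled state `x = X / r`. -/
def fluid {r : ℕ} (X : M.State r) : M.FluidSpace :=
  WithLp.toLp 1 (fun k => (X.1 k : ℝ) / r)

/-! ### Departures and placements -/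

/-- The `i`-th unit vector. -/
abbrev e (i : Fin I) : Fin I → ℕ := Pi.single i 1

/-- The number of servers in an arbitrary configuration, with the convention that the count for
the empty configuration is `0`. -/
def count (X : M.Config → ℕ) (k : Fin I → ℕ) : ℕ :=
  if h : k ∈ M.Kbar.erase 0 then X ⟨k, h⟩ else 0

/-- The server counts after a type-`i` customer leaves a server in configuration `k` (used only
when `1 ≤ k i` and `0 < X k`). -/
def depart (X : M.Config → ℕ) (k : M.Config) (i : Fin I) : M.Config → ℕ := fun l =>
  if l = k then X l - 1 else if l.1 = k.1 - e i then X l + 1 else X l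

/-- The server counts after a type-`i` customer is placed into a server in configuration
`k - e i`, which thereby turns into a server in configuration `k`. -/
def arrive (X : M.Config → ℕ) (k : M.Config) (i : Fin I) : M.Config → ℕ := fun l =>
  if l = k then X l + 1 else if l.1 = k.1 - e i then X l - 1 else X l

/-- A type-`i` customer can be placed into a server in configuration `k - e i`: either such a server
is present, or `k - e i = 0` and an empty server is used. -/
def CanPlace (X : M.Config → ℕ) (i : Fin I) (k : M.Config) : Prop :=
  1 ≤ k.1 i ∧ (k.1 - e i = 0 ∨ 0 < M.count X (k.1 - e i))

/-! ### The policy GSS -/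

/-- The weight function `w(n) = min 1 (n / r ^ p)`. -/
def weight (p : ℝ) (r n : ℕ) : ℝ := min 1 ((n : ℝ) / (r : ℝ) ^ p)

/-- The weight difference `w(X k) - w(X (k - e i))`. -/
def weightDiff (p : ℝ) (r : ℕ) (X : M.Config → ℕ) (k : M.Config) (i : Fin I) : ℝ :=
  weight p r (X k) - weight p r (M.count X (k.1 - e i))

/-- Placing a type-`i` customer into a server in configuration `k - e i` is possible and minimizes
the weight difference among all possible placements. -/
def IsGreedyPlacement (p : ℝ) (r : ℕ) (X : M.Config → ℕ) (i : Fin I) (k : M.Config) : Prop :=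
  M.CanPlace X i k ∧ ∀ k', M.CanPlace X i k' → M.weightDiff p r X k i ≤ M.weightDiff p r X k' i

/-- A version of the policy GSS for the system with `r` customers, i.e. GSS with an arbitrary
(Markovian, possibly randomized) way of breaking ties. When, in state `X`, a type-`i` customer
completes its service requirement in a server in configuration `k`, it leaves that server and is then
placed so as to create a server in a configuration drawn from the distribution `place X k i`, which
charges only the greedy placements for the counts seen after the departure. -/
structure GSS (p : ℝ) (r : ℕ) where
  place : M.State r → M.Config → Fin I → PMF M.Config
  greedy : ∀ (X : M.State r) (k : M.Config) (i : Fin I), 0 < X.1 k → 1 ≤ k.1 i →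
    ∀ k' ∈ (place X k i).support, M.IsGreedyPlacement p r (M.depart X.1 k i) i k'

namespace GSS

variable {M} {p : ℝ} {r : ℕ} (G : M.GSS p r)

/-- The rate at which the system moves from `X` to `Y` (for `Y = X` this is the rate of the
migrations that do not change the state): type-`i` customers leave servers in configuration `k` at
total rate `k i * μ i * X k`. -/
def rate (X Y : M.State r) : ℝ :=
  ∑ k : M.Config, ∑ i : Fin I, (k.1 i : ℝ) * M.μ i * X.1 k *
    ∑ k' : M.Config, (G.place X k i k').toReal *
      if Y.1 = M.arrive (M.depart X.1 k i) k' i then 1 else 0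

/-- The generator (`Q`-matrix) of the continuous-time Markov chain of system states. -/
def generator : Matrix (M.State r) (M.State r) ℝ :=
  Matrix.of G.rate - Matrix.diagonal (fun X => ∑ Y, G.rate X Y)

/-- The transition probabilities over a time interval of length `t`. -/
def transition (t : ℝ) : Matrix (M.State r) (M.State r) ℝ :=
  NormedSpace.exp (t • G.generator)

/-- `ν` is a stationary distribution of the Markov chain of system states. -/
def IsStationary (ν : Measure (M.State r)) : Prop :=
  IsProbabilityMeasure ν ∧
    ∀ t : ℝ, 0 ≤ t → ∀ Y : M.State r, ∑ X, ν.real {X} * G.transition t X Y = ν.real {Y}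

end GSS

end PackingModel

end

namespace PackingModel

variable {I : ℕ} (M : PackingModel I)

/-! ### The linear program: sharpness of the minimum -/

/-! GSS is approximately greedy descent for `cost`, the sum over `k` of the antiderivative of the
weight at `X k`. As the weight has Lipschitz constant `r ^ (-p)`, a migration out of `k` changes
`cost` by at most `4 r ^ (-p)` minus the excess, i.e. the positive part of the gap between the
weight difference at `k` and the lowest one available (`cost_migration_le`). The `r` customers
migrate at bounded rates and `cost` has mean drift zero under a stationary law, so `totalExcess` has
mean `O(r ^ (1 - p))`. By Markov's inequality it exceeds `c * r ^ p` with probability `O(r ^ (1 - 2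
* p))`, which vanishes because `p > 1/2`.

The rest is deterministic (`exists_infDist_fluid_le`). The positive parts of the lowest weight
differences are feasible prices for the dual program. If `totalExcess` is at most `c * r ^ p`, these
prices are almost tight at every configuration with at least `r ^ p` servers, and compactness
replaces them by exactly tight ones. Only configurations with fewer than `r ^ p` servers then
contribute to the duality gap, each at most `r ^ (p - 1)`, and on a polytope the distance to the
optimal set is bounded linearly by the gap. -/

theorem Config.exists_one_le {M : PackingModel I} (k : M.Config) : ∃ i, 1 ≤ k.1 i := by
  obtain ⟨i, hi⟩ := Function.ne_iff.mp (Finset.mem_erase.mp k.2).1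
  exact ⟨i, Nat.one_le_iff_ne_zero.mpr hi⟩

theorem convex_lpFeasible : Convex ℝ M.lpFeasible := by
  intro x hx y hy a b ha hb hab
  refine ⟨fun k => ?_, fun i => ?_⟩
  · simpa using add_nonneg (mul_nonneg ha (hx.1 k)) (mul_nonneg hb (hy.1 k))
  · have : ∀ k : M.Config, (k.1 i : ℝ) * (a • x + b • y) k =
        a * ((k.1 i : ℝ) * x k) + b * ((k.1 i : ℝ) * y k) := by
      intro k; simp; ring
    simp only [this, Finset.sum_add_distrib, ← Finset.mul_sum, hx.2 i, hy.2 i, ← add_mul, hab,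
      one_mul]

theorem isClosed_lpFeasible : IsClosed M.lpFeasible := by
  have : M.lpFeasible = (⋂ k, {x | 0 ≤ x k}) ∩
      ⋂ i, {x | ∑ k : M.Config, (k.1 i : ℝ) * x k = M.ρ i} := by
    ext x; simp [lpFeasible]
  rw [this]
  refine (isClosed_iInter fun k => isClosed_le (by fun_prop) (by fun_prop)).inter
    (isClosed_iInter fun i => isClosed_eq (by fun_prop) (by fun_prop))

theorem apply_le_one_of_mem_lpFeasible {x : M.FluidSpace} (hx : x ∈ M.lpFeasible) (k : M.Config) :
    x k ≤ 1 := by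
  obtain ⟨i, hi⟩ := k.exists_one_le
  have h1 : (1 : ℝ) ≤ k.1 i := by exact_mod_cast hi
  have h2 : (k.1 i : ℝ) * x k ≤ M.ρ i := by
    rw [← hx.2 i]
    exact Finset.single_le_sum (f := fun l : M.Config => (l.1 i : ℝ) * x l)
      (fun l _ => mul_nonneg (Nat.cast_nonneg _) (hx.1 l)) (Finset.mem_univ k)
  have h3 : M.ρ i ≤ ∑ j, M.ρ j :=
    Finset.single_le_sum (fun j _ => M.ρ_nonneg j) (Finset.mem_univ i)
  have h4 := M.ρ_sum
  nlinarith [hx.1 k]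

theorem isCompact_lpFeasible : IsCompact M.lpFeasible := by
  refine Metric.isCompact_of_isClosed_isBounded M.isClosed_lpFeasible ?_
  refine (Metric.isBounded_closedBall (x := (0 : M.FluidSpace))
    (r := Fintype.card M.Config)).subset ?_
  intro x hx
  rw [mem_closedBall_zero_iff, PiLp.norm_eq_of_L1]
  calc ∑ k, ‖x k‖ ≤ ∑ _k : M.Config, (1 : ℝ) := by
        refine Finset.sum_le_sum fun k _ => ?_
        rw [Real.norm_of_nonneg (hx.1 k)]
        exact M.apply_le_one_of_mem_lpFeasible hx k
    _ = _ := by simp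

/-- An extreme feasible point is determined by its support. -/
theorem eq_of_extreme_of_support_subset {x y : M.FluidSpace}
    (hx : x ∈ M.lpFeasible.extremePoints ℝ) (hy : y ∈ M.lpFeasible)
    (h : ∀ k, x k = 0 → y k = 0) : x = y := by
  obtain ⟨δ, hδ, hδx⟩ : ∃ δ : ℝ, 0 < δ ∧ ∀ k, x k ≠ 0 → δ ≤ x k := by
    rcases (Finset.univ.filter fun k => x k ≠ 0).eq_empty_or_nonempty with he | hne
    · refine ⟨1, one_pos, fun k hk => ?_⟩
      have : k ∈ Finset.univ.filter fun k => x k ≠ 0 := by simpa using hk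
      simp [he] at this
    · obtain ⟨k₀, hk₀, hmin⟩ := Finset.exists_min_image _ (fun k => x k) hne
      exact ⟨x k₀, (hx.1.1 k₀).lt_of_ne' (Finset.mem_filter.mp hk₀).2,
        fun k hk => hmin k (Finset.mem_filter.mpr ⟨Finset.mem_univ k, hk⟩)⟩
  -- Nonzero coordinates of `x` are at least `δ` and those of `x - y` are at most `1` in absolute
  -- value, so `x` can be moved both ways along `x - y`; extremality then forces `x = y`.
  have hmem : ∀ t : ℝ, |t| ≤ δ → x + t • (x - y) ∈ M.lpFeasible := by
    intro t ht
    refine ⟨fun k => ?_, fun i => ?_⟩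
    · by_cases hk : x k = 0
      · simp [hk, h k hk]
      · have h1 := hδx k hk
        have h2 : |x k - y k| ≤ 1 := by
          rw [abs_le]
          constructor <;>
          linarith [hx.1.1 k, hy.1 k, M.apply_le_one_of_mem_lpFeasible hx.1 k,
            M.apply_le_one_of_mem_lpFeasible hy k]
        have h3 : |t * (x k - y k)| ≤ δ := by
          rw [abs_mul]
          nlinarith [abs_nonneg t, abs_nonneg (x k - y k)]
        have h4 := (abs_le.mp h3).1
        simp only [PiLp.add_apply, PiLp.smul_apply, PiLp.sub_apply, smul_eq_mul]
        linarith
    · have : ∀ k : M.Config, (k.1 i : ℝ) * (x + t • (x - y)) k =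
          (k.1 i : ℝ) * x k + t * ((k.1 i : ℝ) * x k - (k.1 i : ℝ) * y k) := by
        intro k; simp; ring
      simp only [this, Finset.sum_add_distrib, ← Finset.mul_sum, Finset.sum_sub_distrib,
        hx.1.2 i, hy.2 i, sub_self, mul_zero, add_zero]
  have hseg : x ∈ openSegment ℝ (x + δ • (x - y)) (x + (-δ) • (x - y)) :=
    ⟨1 / 2, 1 / 2, by norm_num, by norm_num, by norm_num, by module⟩
  have h5 := hx.2 (hmem δ (by rw [abs_of_pos hδ])) (hmem (-δ) (by rw [abs_neg, abs_of_pos hδ])) hseg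
  have h6 : δ • (x - y) = 0 := by simpa using h5
  exact sub_eq_zero.mp ((smul_eq_zero.mp h6).resolve_left hδ.ne')

theorem finite_extremePoints_lpFeasible : (M.lpFeasible.extremePoints ℝ).Finite := by
  classical
  refine Set.Finite.of_finite_image (f := fun x => Finset.univ.filter fun k => x k = 0)
    (Set.toFinite _) ?_
  intro x hx y hy hxy
  refine M.eq_of_extreme_of_support_subset hx hy.1 fun k hk => ?_
  have : k ∈ Finset.univ.filter fun k => x k = 0 := by simp [hk]
  have h2 : k ∈ Finset.univ.filter fun k => y k = 0 := by
    have h3 : (Finset.univ.filter fun k => x k = 0) = Finset.univ.filter fun k => y k = 0 := hxy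
    rwa [h3] at this
  simpa using h2

/-- Krein–Milman; the closure can be dropped because the hull of finitely many points is closed. -/
theorem convexHull_extremePoints_lpFeasible :
    convexHull ℝ (M.lpFeasible.extremePoints ℝ) = M.lpFeasible := by
  rw [← M.finite_extremePoints_lpFeasible.isClosed_convexHull (𝕜 := ℝ) |>.closure_eq]
  exact closure_convexHull_extremePoints M.isCompact_lpFeasible M.convex_lpFeasible

theorem convex_lpOptimal : Convex ℝ M.lpOptimal := by
  intro x hx y hy a b ha hb hab
  refine ⟨M.convex_lpFeasible hx.1 hy.1 ha hb hab, fun z hz => ?_⟩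
  have : ∑ k, (a • x + b • y) k = a * ∑ k, x k + b * ∑ k, y k := by
    simp [Finset.sum_add_distrib, Finset.mul_sum]
  rw [this]
  have h1 := hx.2 z hz
  have h2 := hy.2 z hz
  calc a * ∑ k, x k + b * ∑ k, y k ≤ a * ∑ k, z k + b * ∑ k, z k := by gcongr
    _ = ∑ k, z k := by rw [← add_mul, hab, one_mul]

/-- The distance to the set of optimal solutions is at most a constant times the optimality gap. -/
theorem exists_infDist_lpOptimal_le :
    ∃ C : ℝ, 0 < C ∧ ∀ x ∈ M.lpFeasible, ∀ b : ℝ, (∀ u ∈ M.lpFeasible, b ≤ ∑ k, u k) →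
      Metric.infDist x M.lpOptimal ≤ C * (∑ k, x k - b) := by
  rcases M.lpFeasible.eq_empty_or_nonempty with he | hne
  · exact ⟨1, one_pos, fun x hx => by simp [he] at hx⟩
  have hcont : Continuous fun x : M.FluidSpace => ∑ k, x k := by fun_prop
  obtain ⟨u₀, hu₀, hmin⟩ := M.isCompact_lpFeasible.exists_isMinOn hne hcont.continuousOn
  have hopt : u₀ ∈ M.lpOptimal := ⟨hu₀, fun y hy => hmin hy⟩
  -- A nonoptimal vertex has a positive gap and there are finitely many vertices, so the sum of all
  -- the ratios of distance to gap serves as a constant.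
  have hvert : ∃ C : ℝ, 0 < C ∧ ∀ v ∈ M.lpFeasible.extremePoints ℝ,
      v ∉ M.lpOptimal → ‖v - u₀‖ ≤ C * (∑ k, v k - ∑ k, u₀ k) := by
    have hfin := M.finite_extremePoints_lpFeasible
    refine ⟨1 + ∑ v ∈ hfin.toFinset, ‖v - u₀‖ / |∑ k, v k - ∑ k, u₀ k|, by positivity, ?_⟩
    intro v hv hvo
    have hgap : 0 < ∑ k, v k - ∑ k, u₀ k := by
      by_contra hcon
      exact hvo ⟨hv.1, fun y hy => (not_lt.mp fun h => hcon (sub_pos.mpr h)).trans (hmin hy)⟩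
    have h1 : ‖v - u₀‖ / |∑ k, v k - ∑ k, u₀ k| ≤
        ∑ v ∈ hfin.toFinset, ‖v - u₀‖ / |∑ k, v k - ∑ k, u₀ k| :=
      Finset.single_le_sum (f := fun v : M.FluidSpace => ‖v - u₀‖ / |∑ k, v k - ∑ k, u₀ k|)
        (fun _ _ => by positivity) (hfin.mem_toFinset.mpr hv)
    rw [abs_of_pos hgap, div_le_iff₀ hgap] at h1
    nlinarith
  obtain ⟨C, hC, hCv⟩ := hvert
  refine ⟨C, hC, ?_⟩
  -- The gap is affine and `lpOptimal` is convex, so `S` is convex and the bound passes from the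
  -- vertices to their hull.
  let S : Set M.FluidSpace :=
    {x | ∃ u ∈ M.lpOptimal, ‖x - u‖ ≤ C * (∑ k, x k - ∑ k, u₀ k)}
  have hSconv : Convex ℝ S := by
    rintro x ⟨u, hu, hxu⟩ y ⟨v, hv, hyv⟩ a b ha hb hab
    refine ⟨a • u + b • v, M.convex_lpOptimal hu hv ha hb hab, ?_⟩
    have h1 : a • x + b • y - (a • u + b • v) = a • (x - u) + b • (y - v) := by module
    have h2 : ∑ k, (a • x + b • y) k = a * ∑ k, x k + b * ∑ k, y k := by
      simp [Finset.sum_add_distrib, Finset.mul_sum]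
    rw [h1, h2]
    calc ‖a • (x - u) + b • (y - v)‖ ≤ a * ‖x - u‖ + b * ‖y - v‖ := by
          refine (norm_add_le _ _).trans_eq ?_
          rw [norm_smul, norm_smul, Real.norm_of_nonneg ha, Real.norm_of_nonneg hb]
      _ ≤ a * (C * (∑ k, x k - ∑ k, u₀ k)) + b * (C * (∑ k, y k - ∑ k, u₀ k)) := by gcongr
      _ = C * (a * ∑ k, x k + b * ∑ k, y k - (a + b) * ∑ k, u₀ k) := by ring
      _ = _ := by rw [hab, one_mul]
  have hsub : M.lpFeasible ⊆ S := by
    rw [← M.convexHull_extremePoints_lpFeasible]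
    refine convexHull_min (fun v hv => ?_) hSconv
    by_cases hvo : v ∈ M.lpOptimal
    · refine ⟨v, hvo, ?_⟩
      rw [sub_self, norm_zero]
      exact mul_nonneg hC.le (sub_nonneg.mpr (hmin hv.1))
    · exact ⟨u₀, hopt, hCv v hv hvo⟩
  intro x hx b hb
  obtain ⟨u, hu, hxu⟩ := hsub hx
  calc Metric.infDist x M.lpOptimal ≤ dist x u := Metric.infDist_le_dist_of_mem hu
    _ ≤ C * (∑ k, x k - ∑ k, u₀ k) := by rwa [dist_eq_norm]
    -- Allowing any lower bound `b` lets a dual value be inserted without strong duality.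
    _ ≤ C * (∑ k, x k - b) := by gcongr; exact hb u₀ hu₀

/-! ### The dual linear program -/

/-- The feasible set of the dual linear program, restricted to nonnegative prices. -/
def dualFeasible : Set (Fin I → ℝ) :=
  {η | (∀ i, 0 ≤ η i) ∧ ∀ k : M.Config, ∑ i, (k.1 i : ℝ) * η i ≤ 1}

theorem e_mem (i : Fin I) : e i ∈ M.Kbar.erase 0 :=
  Finset.mem_erase.mpr ⟨by simp [e], M.unit_mem i⟩

theorem isCompact_dualFeasible : IsCompact M.dualFeasible := by
  refine (isCompact_Icc (a := (0 : Fin I → ℝ)) (b := 1)).of_isClosed_subset ?_ ?_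
  · have : M.dualFeasible = (⋂ i, {η | 0 ≤ η i}) ∩
        ⋂ k : M.Config, {η | ∑ i, (k.1 i : ℝ) * η i ≤ 1} := by
      ext x; simp [dualFeasible]
    rw [this]
    exact (isClosed_iInter fun k => isClosed_le (by fun_prop) (by fun_prop)).inter
      (isClosed_iInter fun i => isClosed_le (by fun_prop) (by fun_prop))
  · intro η hη
    refine ⟨fun i => hη.1 i, fun i => ?_⟩
    simpa [e, Pi.single_apply] using hη.2 ⟨e i, M.e_mem i⟩

/-- The right-hand side measures the failure of complementary slackness: configurations at which the
prices are tight drop out. -/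
theorem weak_duality {η : Fin I → ℝ} {x : M.FluidSpace} (hx : x ∈ M.lpFeasible) :
    ∑ k, x k - ∑ i, M.ρ i * η i = ∑ k : M.Config, x k * (1 - ∑ i, (k.1 i : ℝ) * η i) := by
  simp only [mul_sub, mul_one, Finset.sum_sub_distrib, ← hx.2, Finset.sum_mul, Finset.mul_sum]
  rw [Finset.sum_comm]
  congr 1
  exact Finset.sum_congr rfl fun k _ => Finset.sum_congr rfl fun i _ => by ring

/-- If no feasible prices are tight on all of `S`, the total slack on `S` has a positive minimum
over the compact dual polytope, so the individual slacks cannot all be tiny. -/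
theorem exists_tight_of_almost_tight_on (S : Set M.Config) :
    ∃ ε : ℝ, 0 < ε ∧ ∀ η ∈ M.dualFeasible, (∀ k ∈ S, 1 - ε < ∑ i, (k.1 i : ℝ) * η i) →
      ∃ η' ∈ M.dualFeasible, ∀ k ∈ S, ∑ i, (k.1 i : ℝ) * η' i = 1 := by
  classical
  by_cases hS : ∃ η' ∈ M.dualFeasible, ∀ k ∈ S, ∑ i, (k.1 i : ℝ) * η' i = 1
  · exact ⟨1, one_pos, fun _ _ _ => hS⟩
  rcases M.dualFeasible.eq_empty_or_nonempty with he | hne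
  · exact ⟨1, one_pos, fun η hη => by simp [he] at hη⟩
  let f : (Fin I → ℝ) → ℝ := fun η =>
    ∑ k : M.Config, if k ∈ S then 1 - ∑ i, (k.1 i : ℝ) * η i else 0
  have hf : Continuous f := by
    refine continuous_finsetSum _ fun k _ => ?_
    split_ifs <;> fun_prop
  obtain ⟨η₀, hη₀, hmin⟩ := M.isCompact_dualFeasible.exists_isMinOn hne hf.continuousOn
  have hterm : ∀ η ∈ M.dualFeasible, ∀ k : M.Config,
      0 ≤ if k ∈ S then 1 - ∑ i, (k.1 i : ℝ) * η i else 0 := by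
    intro η hη k
    split_ifs
    · exact sub_nonneg.mpr (hη.2 k)
    · exact le_rfl
  have hpos : 0 < f η₀ := by
    refine (Finset.sum_nonneg fun k _ => hterm η₀ hη₀ k).lt_of_ne fun h0 => hS ⟨η₀, hη₀, ?_⟩
    intro k hk
    have h1 := (Finset.sum_eq_zero_iff_of_nonneg fun k _ => hterm η₀ hη₀ k).mp h0.symm k
      (Finset.mem_univ k)
    rw [if_pos hk] at h1
    linarith
  refine ⟨f η₀ / (Fintype.card M.Config + 1), by positivity, fun η hη hk => ?_⟩
  exfalso
  have h2 : f η ≤ ∑ _k : M.Config, f η₀ / (Fintype.card M.Config + 1) := by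
    refine Finset.sum_le_sum fun k _ => ?_
    split_ifs with hkS
    · linarith [hk k hkS]
    · positivity
  rw [Finset.sum_const, Finset.card_univ, nsmul_eq_mul] at h2
  have h3 : f η₀ ≤ f η := hmin hη
  have h4 : (Fintype.card M.Config : ℝ) * (f η₀ / (Fintype.card M.Config + 1)) < f η₀ := by
    rw [mul_div_assoc', div_lt_iff₀ (by positivity)]
    nlinarith
  linarith

/-- Prices that almost satisfy the complementary slackness conditions for a set of configurations
can be replaced by prices that satisfy them exactly. -/
theorem exists_tight_of_almost_tight :
    ∃ ε : ℝ, 0 < ε ∧ ∀ S : Set M.Config, ∀ η ∈ M.dualFeasible,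
      (∀ k ∈ S, 1 - ε < ∑ i, (k.1 i : ℝ) * η i) →
      ∃ η' ∈ M.dualFeasible, ∀ k ∈ S, ∑ i, (k.1 i : ℝ) * η' i = 1 := by
  choose ε hε h using M.exists_tight_of_almost_tight_on
  obtain ⟨S₀, hS₀⟩ := Finite.exists_min ε
  refine ⟨ε S₀, hε S₀, fun S η hη hk => h S η hη fun k hkS => ?_⟩
  linarith [hk k hkS, hS₀ S]

end PackingModel

namespace PackingModel

variable {I : ℕ} (M : PackingModel I)

/-! ### The weight function -/

section Weight

variable (p : ℝ) (r : ℕ)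

theorem weight_zero : weight p r 0 = 0 := by simp [weight]

theorem weight_nonneg (n : ℕ) : 0 ≤ weight p r n := by
  unfold weight; positivity

theorem weight_le_one (n : ℕ) : weight p r n ≤ 1 := min_le_left _ _

theorem weight_mono : Monotone (weight p r) := by
  intro m n h
  unfold weight
  gcongr

theorem weight_le_mul (n : ℕ) : weight p r n ≤ n * ((r : ℝ) ^ p)⁻¹ :=
  (min_le_right _ _).trans_eq (div_eq_mul_inv _ _)

/-- The slope is `r ^ (-p)` and truncation at `1` does not increase it. -/
theorem weight_le_add_of_le_succ {m n : ℕ} (h : m ≤ n + 1) :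
    weight p r m ≤ weight p r n + ((r : ℝ) ^ p)⁻¹ := by
  have h0 : (0 : ℝ) ≤ ((r : ℝ) ^ p)⁻¹ := by positivity
  refine (weight_mono p r h).trans ?_
  unfold weight
  rw [← min_add_add_right]
  refine min_le_min (by linarith) (le_of_eq ?_)
  push_cast
  rw [div_eq_mul_inv, div_eq_mul_inv]
  ring

variable {p r}

theorem pos_of_weight_pos {n : ℕ} (h : 0 < weight p r n) : 0 < n := by
  rcases Nat.eq_zero_or_pos n with rfl | hn
  · simp [weight_zero] at h
  · exact hn

theorem weight_eq_one {n : ℕ} (h0 : 0 < (r : ℝ) ^ p) (h : (r : ℝ) ^ p ≤ n) :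
    weight p r n = 1 :=
  min_eq_left ((one_le_div h0).mpr h)

theorem weight_mul_le {n : ℕ} (h0 : 0 < (r : ℝ) ^ p) :
    weight p r n * (r : ℝ) ^ p ≤ n := by
  have := weight_le_mul p r n
  rwa [← div_eq_mul_inv, le_div_iff₀ h0] at this

end Weight

/-! ### Counts after a departure and a placement -/

section Counts

variable {M}

theorem count_apply (X : M.Config → ℕ) (k : M.Config) : M.count X k.1 = X k := by
  simp [count, k.2]

theorem count_zero (X : M.Config → ℕ) : M.count X 0 = 0 := by simp [count]

theorem sub_e_add_e {k : Fin I → ℕ} {i : Fin I} (h : 1 ≤ k i) : k - e i + e i = k := by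
  funext j
  by_cases hj : j = i
  · subst hj; simp [e]; omega
  · simp [e, hj]

theorem sub_e_ne {k : Fin I → ℕ} {i : Fin I} (h : 1 ≤ k i) : k - e i ≠ k := by
  intro h'
  have := congrFun h' i
  simp [e] at this
  omega

theorem sub_e_mem {k : Fin I → ℕ} (hk : k ∈ M.Kbar) (i : Fin I) : k - e i ∈ M.Kbar :=
  M.monotone k hk _ (fun _ => Nat.sub_le _ _)

theorem Config.sub_e_mem (k : M.Config) (i : Fin I) : k.1 - e i ∈ M.Kbar :=
  PackingModel.sub_e_mem (Finset.mem_of_mem_erase k.2) i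

theorem sum_ite_config (k : M.Config) {m : Fin I → ℕ} (hm : m ≠ k.1) (a : ℝ)
    (b : M.Config → ℝ) :
    ∑ l : M.Config, (if l = k then a else if l.1 = m then b l else 0) =
      a + if h : m ∈ M.Kbar.erase 0 then b ⟨m, h⟩ else 0 := by
  have h1 : ∀ l : M.Config, (if l = k then a else if l.1 = m then b l else 0) =
      (if l = k then a else 0) + if l.1 = m then b l else 0 := by
    intro l
    by_cases hl : l = k
    · subst hl; simp [hm.symm]
    · simp [hl]
  simp only [h1, Finset.sum_add_distrib, Finset.sum_ite_eq', Finset.mem_univ, if_true]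
  congr 1
  split_ifs with h
  · have : ∀ l : M.Config, (if l.1 = m then b l else 0) = if l = ⟨m, h⟩ then b l else 0 := by
      intro l; simp [Subtype.ext_iff]
    simp [this]
  · refine Finset.sum_eq_zero fun l _ => if_neg ?_
    rintro rfl
    exact h l.2

/-- Shared by `depart` and `arrive`, which alter only `k` and `m = k - e i`. It is applied to
customer numbers and to `cost`; the `else` branch covers the uncounted empty configuration. -/
theorem sum_update_config (X : M.Config → ℕ) (g : M.Config → ℕ → ℝ) (k : M.Config)
    {m : Fin I → ℕ} (hm : m ≠ k.1) (a b : ℕ → ℕ) :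
    ∑ l : M.Config, g l (if l = k then a (X l) else if l.1 = m then b (X l) else X l) =
      ∑ l, g l (X l) + (g k (a (X k)) - g k (X k)) +
        if h : m ∈ M.Kbar.erase 0 then g ⟨m, h⟩ (b (X ⟨m, h⟩)) - g ⟨m, h⟩ (X ⟨m, h⟩) else 0 := by
  rw [add_assoc, ← sum_ite_config k hm (g k (a (X k)) - g k (X k)) (fun l => g l (b (X l)) - g l (X l)),
    ← Finset.sum_add_distrib]
  refine Finset.sum_congr rfl fun l _ => ?_
  split_ifs with h1 h2
  · subst h1; ring
  · ring
  · ring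

theorem depart_apply_self (X : M.Config → ℕ) (k : M.Config) (i : Fin I) :
    depart M X k i k = X k - 1 := if_pos rfl

theorem count_depart_sub_e_ne_zero {X : M.Config → ℕ} {k : M.Config} {i : Fin I} (hk : 1 ≤ k.1 i)
    (h : k.1 - e i ≠ 0) : M.count (depart M X k i) (k.1 - e i) = M.count X (k.1 - e i) + 1 := by
  have hmem : k.1 - e i ∈ M.Kbar.erase 0 := Finset.mem_erase.mpr ⟨h, k.sub_e_mem i⟩
  have hne : (⟨k.1 - e i, hmem⟩ : M.Config) ≠ k := fun h' => sub_e_ne hk (congrArg Subtype.val h')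
  unfold count depart
  rw [dif_pos hmem, dif_pos hmem, if_neg hne, if_pos rfl]

theorem count_le_count_depart_add_one (X : M.Config → ℕ) (k : M.Config) (i : Fin I)
    (m : Fin I → ℕ) : M.count X m ≤ M.count (depart M X k i) m + 1 := by
  unfold count depart
  split_ifs with h1 h2 h3
  · rw [h2]; omega
  all_goals omega

theorem count_depart_le_count_add_one (X : M.Config → ℕ) (k : M.Config) (i : Fin I)
    (m : Fin I → ℕ) : M.count (depart M X k i) m ≤ M.count X m + 1 := by
  unfold count depart
  split_ifs with h1 h2 h3
  · rw [h2]; omega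
  all_goals omega

theorem eq_of_count_depart_lt {X : M.Config → ℕ} {k : M.Config} {i : Fin I}
    {m : Fin I → ℕ} (h : M.count (depart M X k i) m < M.count X m) : m = k.1 := by
  unfold count depart at h
  split_ifs at h with h1 h2 h3
  · exact congrArg Subtype.val h2
  all_goals omega

/-- The customer may go back to the server it left; greedy placement is compared with this option.
-/
theorem canPlace_depart {X : M.Config → ℕ} {k : M.Config} {i : Fin I} (hk : 1 ≤ k.1 i) :
    M.CanPlace (depart M X k i) i k := by
  refine ⟨hk, ?_⟩
  by_cases h : k.1 - e i = 0
  · exact Or.inl h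
  · exact Or.inr (by rw [count_depart_sub_e_ne_zero hk h]; omega)

theorem canPlace_e (X : M.Config → ℕ) (i : Fin I) : M.CanPlace X i ⟨e i, M.e_mem i⟩ :=
  ⟨by simp [e], Or.inl (by simp)⟩

theorem cast_sub_e_add {k : Fin I → ℕ} {i : Fin I} (h : 1 ≤ k i) (j : Fin I) :
    (((k - e i) j : ℕ) : ℝ) + ((e i : Fin I → ℕ) j : ℝ) = k j := by
  exact_mod_cast congrFun (sub_e_add_e h) j

theorem sum_depart {X : M.Config → ℕ} {k : M.Config} {i : Fin I} (hX : 0 < X k) (hk : 1 ≤ k.1 i)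
    (j : Fin I) :
    ∑ l : M.Config, (l.1 j : ℝ) * (depart M X k i l : ℕ) =
      ∑ l : M.Config, (l.1 j : ℝ) * X l - ((e i : Fin I → ℕ) j : ℝ) := by
  have h1 := sum_update_config X (fun l n => (l.1 j : ℝ) * n) k (sub_e_ne hk) (· - 1) (· + 1)
  have h2 : (if h : k.1 - e i ∈ M.Kbar.erase 0 then
      (((k.1 - e i) j : ℕ) : ℝ) * ((X ⟨k.1 - e i, h⟩ + 1 : ℕ) : ℝ) -
        (((k.1 - e i) j : ℕ) : ℝ) * (X ⟨k.1 - e i, h⟩ : ℝ) else 0) =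
      (((k.1 - e i) j : ℕ) : ℝ) := by
    split_ifs with h
    · push_cast; ring
    · have : k.1 - e i = 0 := by
        by_contra h0
        exact h (Finset.mem_erase.mpr ⟨h0, k.sub_e_mem i⟩)
      have h0 : (k.1 - e i) j = 0 := by rw [this]; rfl
      rw [h0]; simp
  have h3 := cast_sub_e_add hk j
  have h4 : ((X k - 1 : ℕ) : ℝ) = X k - 1 := by rw [Nat.cast_sub hX]; simp
  refine h1.trans ?_
  rw [h2, h4]
  linarith

theorem sum_arrive {X : M.Config → ℕ} {k : M.Config} {i : Fin I} (hk : M.CanPlace X i k)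
    (j : Fin I) :
    ∑ l : M.Config, (l.1 j : ℝ) * (arrive M X k i l : ℕ) =
      ∑ l : M.Config, (l.1 j : ℝ) * X l + ((e i : Fin I → ℕ) j : ℝ) := by
  have h1 := sum_update_config X (fun l n => (l.1 j : ℝ) * n) k (sub_e_ne hk.1) (· + 1) (· - 1)
  have h2 : (if h : k.1 - e i ∈ M.Kbar.erase 0 then
      (((k.1 - e i) j : ℕ) : ℝ) * ((X ⟨k.1 - e i, h⟩ - 1 : ℕ) : ℝ) -
        (((k.1 - e i) j : ℕ) : ℝ) * (X ⟨k.1 - e i, h⟩ : ℝ) else 0) =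
      -(((k.1 - e i) j : ℕ) : ℝ) := by
    split_ifs with h
    · have hpos : 0 < X ⟨k.1 - e i, h⟩ := by
        rw [← count_apply X ⟨_, h⟩]
        exact hk.2.resolve_left (Finset.mem_erase.mp h).1
      rw [Nat.cast_sub hpos]
      push_cast; ring
    · have : k.1 - e i = 0 := by
        by_contra h0
        exact h (Finset.mem_erase.mpr ⟨h0, k.sub_e_mem i⟩)
      have h0 : (k.1 - e i) j = 0 := by rw [this]; rfl
      rw [h0]; simp
  have h3 := cast_sub_e_add hk.1 j
  refine h1.trans ?_
  rw [h2]
  push_cast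
  linarith

end Counts

/-! ### The Lyapunov function -/

section Cost

variable (p : ℝ) (r : ℕ)

/-- The antiderivative of the weight function. -/
noncomputable def potential (n : ℕ) : ℝ := ∑ m ∈ Finset.range n, weight p r m

/-- The function of the counts that GSS decreases greedily. -/
noncomputable def cost (X : M.Config → ℕ) : ℝ := ∑ k, potential p r (X k)

/-- The lowest weight difference among the possible placements of a type-`i` customer. -/
noncomputable def price (X : M.Config → ℕ) (i : Fin I) : ℝ :=
  ⨅ k : {k : M.Config // M.CanPlace X i k}, M.weightDiff p r X k.1 i

/-- The positive part of the decrease of `cost` when a type-`i` customer leaves configuration `k`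
and is placed greedily. -/
noncomputable def excess (X : M.Config → ℕ) (k : M.Config) (i : Fin I) : ℝ :=
  max 0 (M.weightDiff p r X k i - M.price p r X i)

variable {M}

theorem price_le {X : M.Config → ℕ} {i : Fin I} {k : M.Config} (hk : M.CanPlace X i k) :
    M.price p r X i ≤ M.weightDiff p r X k i :=
  ciInf_le (f := fun k : {k : M.Config // M.CanPlace X i k} => M.weightDiff p r X k.1 i)
    (Set.finite_range _).bddBelow ⟨k, hk⟩

theorem exists_weightDiff_eq_price (X : M.Config → ℕ) (i : Fin I) :
    ∃ k, M.CanPlace X i k ∧ M.weightDiff p r X k i = M.price p r X i := by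
  have : Nonempty {k : M.Config // M.CanPlace X i k} := ⟨⟨_, canPlace_e X i⟩⟩
  obtain ⟨k, hk⟩ := exists_eq_ciInf_of_finite
    (f := fun k : {k : M.Config // M.CanPlace X i k} => M.weightDiff p r X k.1 i)
  exact ⟨k.1, k.2, hk⟩

theorem cost_depart {X : M.Config → ℕ} {k : M.Config} {i : Fin I} (hX : 0 < X k) (hk : 1 ≤ k.1 i) :
    M.cost p r (depart M X k i) =
      M.cost p r X - weight p r (X k - 1) + weight p r (M.count X (k.1 - e i)) := by
  have h1 := sum_update_config X (fun _ n => potential p r n) k (sub_e_ne hk) (· - 1) (· + 1)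
  obtain ⟨n, hn⟩ : ∃ n, X k = n + 1 := ⟨X k - 1, by omega⟩
  refine h1.trans ?_
  have h2 : (if h : k.1 - e i ∈ M.Kbar.erase 0 then
      potential p r (X ⟨k.1 - e i, h⟩ + 1) - potential p r (X ⟨k.1 - e i, h⟩) else 0) =
      weight p r (M.count X (k.1 - e i)) := by
    unfold count potential
    split_ifs with h
    · rw [Finset.sum_range_succ]; ring
    · rw [weight_zero]
  have h3 : potential p r (n + 1) = potential p r n + weight p r n := Finset.sum_range_succ _ _
  rw [h2, hn, Nat.add_sub_cancel, h3, cost]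
  ring

theorem cost_arrive {X : M.Config → ℕ} {k : M.Config} {i : Fin I} (hk : M.CanPlace X i k) :
    M.cost p r (arrive M X k i) =
      M.cost p r X + weight p r (X k) - weight p r (M.count X (k.1 - e i) - 1) := by
  have h1 := sum_update_config X (fun _ n => potential p r n) k (sub_e_ne hk.1) (· + 1) (· - 1)
  refine h1.trans ?_
  have h2 : (if h : k.1 - e i ∈ M.Kbar.erase 0 then
      potential p r (X ⟨k.1 - e i, h⟩ - 1) - potential p r (X ⟨k.1 - e i, h⟩) else 0) =
      -weight p r (M.count X (k.1 - e i) - 1) := by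
    unfold count
    split_ifs with h
    · have hpos : 0 < X ⟨k.1 - e i, h⟩ := by
        rw [← count_apply X ⟨_, h⟩]
        exact hk.2.resolve_left (Finset.mem_erase.mp h).1
      obtain ⟨n, hn⟩ : ∃ n, X ⟨k.1 - e i, h⟩ = n + 1 := ⟨X ⟨k.1 - e i, h⟩ - 1, by omega⟩
      have h3 : potential p r (n + 1) = potential p r n + weight p r n := Finset.sum_range_succ _ _
      rw [hn, Nat.add_sub_cancel, h3]; ring
    · rw [weight_zero, neg_zero]
  have h3 : potential p r (X k + 1) = potential p r (X k) + weight p r (X k) :=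
    Finset.sum_range_succ _ _
  rw [h2, h3, cost]
  ring

/-- One migration changes `cost` by at most `-excess`, up to the Lipschitz constant of `weight`. -/
theorem cost_migration_le {X : M.Config → ℕ} {k k' : M.Config} {i : Fin I} (hX : 0 < X k)
    (hk : 1 ≤ k.1 i) (hk' : M.IsGreedyPlacement p r (depart M X k i) i k') :
    M.cost p r (arrive M (depart M X k i) k' i) - M.cost p r X ≤
      4 * ((r : ℝ) ^ p)⁻¹ - M.excess p r X k i := by
  have hε : (0 : ℝ) ≤ ((r : ℝ) ^ p)⁻¹ := by positivity
  set ε := ((r : ℝ) ^ p)⁻¹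
  set X' := depart M X k i with hX'
  rw [cost_arrive p r hk'.1, cost_depart p r hX hk]
  -- The constant `4` is assembled from one `ε` here, one in `h2` and two in `h6`.
  have h1 : weight p r (X k) ≤ weight p r (X k - 1) + ε := weight_le_add_of_le_succ p r (by omega)
  have h2 : weight p r (M.count X' (k'.1 - e i)) ≤
      weight p r (M.count X' (k'.1 - e i) - 1) + ε := weight_le_add_of_le_succ p r (by omega)
  have h3 : M.weightDiff p r X' k' i ≤ M.weightDiff p r X k i := by
    refine (hk'.2 k (canPlace_depart hk)).trans ?_
    have h4 : weight p r (X' k) ≤ weight p r (X k) := by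
      rw [hX', depart_apply_self]; exact weight_mono p r (Nat.sub_le _ _)
    have h5 : weight p r (M.count X (k.1 - e i)) ≤ weight p r (M.count X' (k.1 - e i)) := by
      by_cases h : k.1 - e i = 0
      · simp [h, count_zero]
      · rw [hX', count_depart_sub_e_ne_zero hk h]; exact weight_mono p r (Nat.le_succ _)
    unfold weightDiff
    linarith
  have h6 : M.weightDiff p r X' k' i - M.weightDiff p r X k i ≤
      2 * ε - M.excess p r X k i := by
    unfold excess
    -- In the second alternative the excess itself is at most `2 * ε`, and `h3` suffices.
    suffices M.weightDiff p r X' k' i - M.price p r X i ≤ 2 * ε ∨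
        M.weightDiff p r X k i - M.price p r X i ≤ 2 * ε by
      rcases max_cases 0 (M.weightDiff p r X k i - M.price p r X i) with h | h <;>
        rw [h.1] <;> rcases this with h' | h' <;> linarith
    obtain ⟨l, hl, hle⟩ := exists_weightDiff_eq_price p r X i
    rw [← hle]
    by_cases hl' : M.CanPlace X' i l
    · left
      have h7 := hk'.2 l hl'
      have h8 : weight p r (X' l) ≤ weight p r (X l) + ε := by
        refine weight_le_add_of_le_succ p r ?_
        rw [← count_apply X, ← count_apply X']
        exact count_depart_le_count_add_one X k i l.1
      have h9 : weight p r (M.count X (l.1 - e i)) ≤ weight p r (M.count X' (l.1 - e i)) + ε :=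
        weight_le_add_of_le_succ p r (count_le_count_depart_add_one X k i _)
      unfold weightDiff at h7 ⊢
      linarith
    -- The departure made the optimal `l` unavailable by removing the last server in `l - e i`.
    -- Hence `l - e i = k` and `X k ≤ 1`, so all the weights that matter are at most `ε`.
    · right
      have h10 : l.1 - e i ≠ 0 ∧ M.count X' (l.1 - e i) = 0 := by
        unfold CanPlace at hl'
        refine ⟨fun h => hl' ⟨hl.1, Or.inl h⟩, ?_⟩
        by_contra h
        exact hl' ⟨hl.1, Or.inr (Nat.pos_of_ne_zero h)⟩
      have h11 : 0 < M.count X (l.1 - e i) := hl.2.resolve_left h10.1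
      have h12 : l.1 - e i = k.1 := eq_of_count_depart_lt (by rw [← hX', h10.2]; exact h11)
      have h13 : M.count X (l.1 - e i) ≤ 1 := by
        have := count_le_count_depart_add_one X k i (l.1 - e i)
        rwa [← hX', h10.2] at this
      have h14 : weight p r (M.count X (l.1 - e i)) ≤ ε := by
        have := weight_le_add_of_le_succ p r (n := 0) (by simpa using h13)
        rwa [weight_zero, zero_add] at this
      have h15 : weight p r (X k) ≤ ε := by
        rwa [h12, count_apply] at h14
      have h16 := weight_nonneg p r (X l)
      have h17 := weight_nonneg p r (M.count X (k.1 - e i))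
      unfold weightDiff
      linarith
  unfold weightDiff at h6
  unfold weightDiff at h3
  linarith

end Cost

end PackingModel

namespace PackingModel

variable {I : ℕ} {M : PackingModel I} {p : ℝ} {r : ℕ}

/-! ### States of small total excess are nearly optimal -/

theorem config_induction {P : (Fin I → ℕ) → Prop} (zero : P 0)
    (step : ∀ k ∈ M.Kbar, ∀ i, 1 ≤ k i → P (k - e i) → P k) : ∀ k ∈ M.Kbar, P k := by
  suffices ∀ n : ℕ, ∀ k ∈ M.Kbar, ∑ i, k i = n → P k from fun k hk => this _ k hk rfl
  intro n
  induction n with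
  | zero =>
    intro k _ hs
    have : k = 0 := funext fun i => Finset.sum_eq_zero_iff.mp hs i (Finset.mem_univ i)
    rwa [this]
  | succ n ih =>
    intro k hk hs
    obtain ⟨i, -, hi⟩ : ∃ i ∈ Finset.univ, k i ≠ 0 :=
      Finset.exists_ne_zero_of_sum_ne_zero (by omega)
    have hi : 1 ≤ k i := Nat.one_le_iff_ne_zero.mpr hi
    refine step k hk i hi (ih _ (sub_e_mem hk i) ?_)
    have h1 : ∑ j, (k - e i + e i) j = n + 1 := by rw [sub_e_add_e hi, hs]
    simp only [Pi.add_apply (k - e i) (e i), Finset.sum_add_distrib] at h1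
    have h2 : ∑ j, (e i : Fin I → ℕ) j = 1 := by simp [e]
    omega

theorem sum_mul_sub_e {k : Fin I → ℕ} {i : Fin I} (h : 1 ≤ k i) (η : Fin I → ℝ) :
    ∑ j, (k j : ℝ) * η j = ∑ j, (((k - e i) j : ℕ) : ℝ) * η j + η i := by
  have : η i = ∑ j, ((e i : Fin I → ℕ) j : ℝ) * η j := by
    simp [e, Pi.single_apply]
  rw [this, ← Finset.sum_add_distrib]
  refine Finset.sum_congr rfl fun j _ => ?_
  rw [← cast_sub_e_add h j]
  ring

/-- Build `k` one customer at a time: if `k - e i` is present or empty, the placement is possible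
and the price is at most the weight increment. A positive price makes the weight of `k` positive, so
`k` is present as well and the increments telescope. -/
theorem sum_mul_price_le (X : M.Config → ℕ) :
    ∀ k ∈ M.Kbar, (∀ i, 1 ≤ k i → 0 < M.price p r X i) →
      (k = 0 ∨ 0 < M.count X k) ∧
        ∑ i, (k i : ℝ) * M.price p r X i ≤ weight p r (M.count X k) := by
  refine config_induction (fun _ => by simp [weight_nonneg]) ?_
  intro k hk i hi ih hpos
  obtain ⟨h1, h2⟩ := ih fun j hj => hpos j (hj.trans (Nat.sub_le _ _))
  have hk0 : k ≠ 0 := by rintro rfl; simp at hi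
  have hmem : k ∈ M.Kbar.erase 0 := Finset.mem_erase.mpr ⟨hk0, hk⟩
  have h3 : M.price p r X i ≤ weight p r (M.count X k) - weight p r (M.count X (k - e i)) := by
    have := price_le p r (X := X) (i := i) (k := ⟨k, hmem⟩) ⟨hi, h1⟩
    rwa [weightDiff, ← count_apply X ⟨k, hmem⟩] at this
  have h4 := hpos i hi
  have h5 := weight_nonneg p r (M.count X (k - e i))
  refine ⟨Or.inr (pos_of_weight_pos (p := p) (r := r) (by linarith)), ?_⟩
  rw [sum_mul_sub_e hi]
  linarith

/-- The positive parts of the prices are feasible for the dual linear program. -/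
theorem max_price_mem_dualFeasible (X : M.Config → ℕ) :
    (fun i => max 0 (M.price p r X i)) ∈ M.dualFeasible := by
  refine ⟨fun i => le_max_left _ _, fun k => ?_⟩
  -- Dropping the types with nonpositive price keeps the configuration feasible, by monotonicity,
  -- and does not change its value.
  let k' : Fin I → ℕ := fun i => if 0 < M.price p r X i then k.1 i else 0
  have hk' : k' ∈ M.Kbar := by
    refine M.monotone k.1 (Finset.mem_of_mem_erase k.2) _ fun i => ?_
    simp only [k']
    split_ifs <;> simp
  have h1 := (sum_mul_price_le (p := p) (r := r) X k' hk' fun i hi => by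
    by_contra h
    simp [k', h] at hi).2
  refine le_trans (le_of_eq ?_) (h1.trans (weight_le_one p r _))
  refine Finset.sum_congr rfl fun i _ => ?_
  simp only [k']
  split_ifs with h
  · rw [max_eq_right h.le]
  · rw [max_eq_left (not_lt.mp h)]; simp

variable (M p r) in
/-- The total excess of a state; up to bounded factors, the rate at which `cost` decreases. -/
noncomputable def totalExcess (X : M.Config → ℕ) : ℝ :=
  ∑ k : M.Config, ∑ i, (k.1 i : ℝ) * X k * M.excess p r X k i

theorem excess_nonneg (X : M.Config → ℕ) (k : M.Config) (i : Fin I) :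
    0 ≤ M.excess p r X k i := le_max_left _ _

theorem mul_excess_le_totalExcess (X : M.Config → ℕ) {k : M.Config} {i : Fin I} (hk : 1 ≤ k.1 i) :
    X k * M.excess p r X k i ≤ M.totalExcess p r X := by
  have hterm : ∀ (k : M.Config) (i : Fin I), 0 ≤ (k.1 i : ℝ) * X k * M.excess p r X k i :=
    fun k i => mul_nonneg (by positivity) (excess_nonneg X k i)
  have h1 : (1 : ℝ) ≤ k.1 i := by exact_mod_cast hk
  calc X k * M.excess p r X k i ≤ (k.1 i : ℝ) * (X k * M.excess p r X k i) :=
        le_mul_of_one_le_left (mul_nonneg (by positivity) (excess_nonneg X k i)) h1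
    _ = (k.1 i : ℝ) * X k * M.excess p r X k i := by ring
    _ ≤ ∑ i, (k.1 i : ℝ) * X k * M.excess p r X k i :=
        Finset.single_le_sum (f := fun i => (k.1 i : ℝ) * X k * M.excess p r X k i)
          (fun i _ => hterm k i) (Finset.mem_univ i)
    _ ≤ M.totalExcess p r X :=
        Finset.single_le_sum
          (f := fun k : M.Config => ∑ i, (k.1 i : ℝ) * X k * M.excess p r X k i)
          (fun k _ => Finset.sum_nonneg fun i _ => hterm k i) (Finset.mem_univ k)

/-- Converse telescoping. A weight above `δ` means at least `δ * r ^ p` servers, so the excess at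
`k` is at most `δ` and removing a customer lowers the weight by at most its price plus `δ`. The
additional `δ` covers stopping at a weight below `δ`. -/
theorem weight_count_le {X : M.Config → ℕ} {δ : ℝ} (hδ : 0 < δ) (hr : 0 < (r : ℝ) ^ p)
    (hX : M.totalExcess p r X ≤ δ ^ 2 * (r : ℝ) ^ p) :
    ∀ k ∈ M.Kbar, weight p r (M.count X k) ≤
      ∑ i, (k i : ℝ) * max 0 (M.price p r X i) + (1 + ∑ i, (k i : ℝ)) * δ := by
  refine config_induction (by simp [count_zero, weight_zero, hδ.le]) ?_
  intro k hk i hi ih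
  rcases le_or_gt (weight p r (M.count X k)) δ with hw | hw
  · have h1 : 0 ≤ ∑ i, (k i : ℝ) * max 0 (M.price p r X i) := by positivity
    have h2 : 0 ≤ (∑ i, (k i : ℝ)) * δ := by positivity
    linarith
  have hk0 : k ≠ 0 := by rintro rfl; simp at hi
  have hmem : k ∈ M.Kbar.erase 0 := Finset.mem_erase.mpr ⟨hk0, hk⟩
  have hcount : M.count X k = X ⟨k, hmem⟩ := count_apply X ⟨k, hmem⟩
  have h1 := (mul_excess_le_totalExcess (p := p) (r := r) X (k := ⟨k, hmem⟩) hi).trans hX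
  have h2 : δ * (r : ℝ) ^ p ≤ X ⟨k, hmem⟩ := by
    rw [← hcount]
    exact (mul_le_mul_of_nonneg_right hw.le hr.le).trans (weight_mul_le hr)
  have h3 : M.excess p r X ⟨k, hmem⟩ i ≤ δ := by
    have h4 : (δ * (r : ℝ) ^ p) * M.excess p r X ⟨k, hmem⟩ i ≤ (δ * (r : ℝ) ^ p) * δ :=
      (mul_le_mul_of_nonneg_right h2 (excess_nonneg _ _ _)).trans (h1.trans_eq (by ring))
    exact le_of_mul_le_mul_left h4 (by positivity)
  have h5 : M.weightDiff p r X ⟨k, hmem⟩ i - M.price p r X i ≤ δ := (le_max_right _ _).trans h3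
  rw [weightDiff, ← count_apply X ⟨k, hmem⟩] at h5
  have h6 := sum_mul_sub_e hi (fun i => max 0 (M.price p r X i))
  have h7 := sum_mul_sub_e hi (fun _ => (1 : ℝ))
  simp only [mul_one] at h7
  have h8 : M.price p r X i ≤ max 0 (M.price p r X i) := le_max_right _ _
  rw [h6, h7]
  linarith

theorem fluid_mem_lpFeasible (hr : 0 < r) (X : M.State r) : M.fluid X ∈ M.lpFeasible := by
  have hr' : (0 : ℝ) < r := Nat.cast_pos.mpr hr
  refine ⟨fun k => by simp only [fluid]; positivity, fun i => ?_⟩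
  have : ∀ k : M.Config, (k.1 i : ℝ) * (M.fluid X) k = (k.1 i : ℝ) * X.1 k / r := fun k => by
    simp only [fluid]; ring
  simp only [this, ← Finset.sum_div, X.2 i]
  field_simp

variable (M p) in
theorem exists_infDist_fluid_le :
    ∃ C c : ℝ, 0 < C ∧ 0 < c ∧ ∀ r : ℕ, 0 < r → ∀ X : M.State r,
      M.totalExcess p r X.1 ≤ c * (r : ℝ) ^ p →
      Metric.infDist (M.fluid X) M.lpOptimal ≤ C * (r : ℝ) ^ (p - 1) := by
  obtain ⟨C, hC, hdist⟩ := M.exists_infDist_lpOptimal_le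
  obtain ⟨ε, hε, htight⟩ := M.exists_tight_of_almost_tight
  set B : ℝ := ∑ k : M.Config, ∑ i, (k.1 i : ℝ) with hB
  have hB0 : 0 ≤ B := by positivity
  -- `B` bounds every configuration's number of customers, so the accumulated error `(1 + ∑ i, k i)
  -- * δ` stays below `ε`.
  set δ : ℝ := ε / (B + 2) with hδ
  have hδ0 : 0 < δ := by positivity
  refine ⟨C * (Fintype.card M.Config + 1), δ ^ 2, by positivity, by positivity, ?_⟩
  intro r hr X hX
  have hr' : (0 : ℝ) < r := Nat.cast_pos.mpr hr
  have hrp : 0 < (r : ℝ) ^ p := Real.rpow_pos_of_pos hr' p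
  obtain ⟨η, hη, hη1⟩ := htight {k | (r : ℝ) ^ p ≤ X.1 k} _
    (max_price_mem_dualFeasible (p := p) (r := r) X.1) fun k hk => by
      have h1 := weight_count_le hδ0 hrp hX k.1 (Finset.mem_of_mem_erase k.2)
      rw [count_apply, weight_eq_one hrp hk] at h1
      have h2 : ∑ i, (k.1 i : ℝ) ≤ B :=
        Finset.single_le_sum (f := fun k : M.Config => ∑ i, (k.1 i : ℝ))
          (fun _ _ => by positivity) (Finset.mem_univ k)
      have h3 : (1 + ∑ i, (k.1 i : ℝ)) * δ < ε := by
        calc (1 + ∑ i, (k.1 i : ℝ)) * δ ≤ (1 + B) * δ := by gcongr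
          _ < (B + 2) * δ := mul_lt_mul_of_pos_right (by linarith) hδ0
          _ = ε := by rw [hδ]; field_simp
      linarith
  refine (hdist _ (fluid_mem_lpFeasible hr X) (∑ i, M.ρ i * η i) fun u hu => ?_).trans ?_
  · rw [← sub_nonneg, M.weak_duality hu]
    exact Finset.sum_nonneg fun k _ => mul_nonneg (hu.1 k) (sub_nonneg.mpr (hη.2 k))
  rw [M.weak_duality (fluid_mem_lpFeasible hr X), mul_assoc]
  refine mul_le_mul_of_nonneg_left ?_ hC.le
  have hterm : ∀ k : M.Config, (M.fluid X) k * (1 - ∑ i, (k.1 i : ℝ) * η i) ≤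
      (r : ℝ) ^ (p - 1) := by
    intro k
    by_cases hk : (r : ℝ) ^ p ≤ X.1 k
    · rw [hη1 k hk, sub_self, mul_zero]
      positivity
    · have h1 : 0 ≤ ∑ i, (k.1 i : ℝ) * η i :=
        Finset.sum_nonneg fun i _ => mul_nonneg (by positivity) (hη.1 i)
      have h2 : 0 ≤ (M.fluid X) k := (fluid_mem_lpFeasible hr X).1 k
      calc (M.fluid X) k * (1 - ∑ i, (k.1 i : ℝ) * η i) ≤ (M.fluid X) k :=
            mul_le_of_le_one_right h2 (by linarith)
        _ = (X.1 k : ℝ) / r := rfl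
        _ ≤ (r : ℝ) ^ p / r := by gcongr; exact (not_le.mp hk).le
        _ = (r : ℝ) ^ (p - 1) := by rw [Real.rpow_sub_one hr'.ne']
  calc ∑ k : M.Config, (M.fluid X) k * (1 - ∑ i, (k.1 i : ℝ) * η i)
      ≤ ∑ _k : M.Config, (r : ℝ) ^ (p - 1) := Finset.sum_le_sum fun k _ => hterm k
    _ = Fintype.card M.Config * (r : ℝ) ^ (p - 1) := by simp
    _ ≤ _ := by gcongr; linarith

end PackingModel

namespace PackingModel

variable {I : ℕ} {M : PackingModel I} {p : ℝ} {r : ℕ}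

/-! ### The drift of the Lyapunov function -/

namespace GSS

variable (G : M.GSS p r)

theorem sum_rate_mul (X : M.State r) (f : M.State r → ℝ) :
    ∑ Y, G.rate X Y * f Y =
      ∑ k : M.Config, ∑ i : Fin I, (k.1 i : ℝ) * M.μ i * X.1 k *
        ∑ k' : M.Config, (G.place X k i k').toReal *
          ∑ Y : M.State r, if Y.1 = M.arrive (M.depart X.1 k i) k' i then f Y else 0 := by
  simp only [rate, Finset.sum_mul]
  rw [Finset.sum_comm]
  refine Finset.sum_congr rfl fun k _ => ?_
  rw [Finset.sum_comm]
  refine Finset.sum_congr rfl fun i _ => ?_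
  simp only [mul_assoc, ← Finset.mul_sum, Finset.sum_mul]
  rw [Finset.sum_comm]
  simp only [← Finset.mul_sum, ite_mul, one_mul, zero_mul]

theorem sum_place (X : M.State r) (k : M.Config) (i : Fin I) :
    ∑ k', (G.place X k i k').toReal = 1 := by
  have h := (G.place X k i).tsum_coe
  rw [tsum_fintype] at h
  rw [← ENNReal.toReal_sum fun k' _ => (G.place X k i).apply_ne_top k', h, ENNReal.toReal_one]

theorem sum_customers (X : M.State r) : ∑ k : M.Config, ∑ i, (k.1 i : ℝ) * X.1 k = r := by
  rw [Finset.sum_comm]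
  simp only [X.2, ← Finset.sum_mul, M.ρ_sum, one_mul]

theorem sum_place_mul_le (X : M.State r) {k : M.Config} {i : Fin I} (hX : 0 < X.1 k)
    (hk : 1 ≤ k.1 i) :
    ∑ k' : M.Config, (G.place X k i k').toReal *
      ∑ Y : M.State r, (if Y.1 = M.arrive (M.depart X.1 k i) k' i then
        M.cost p r Y.1 - M.cost p r X.1 else 0) ≤
      4 * ((r : ℝ) ^ p)⁻¹ - M.excess p r X.1 k i := by
  calc _ ≤ ∑ k' : M.Config, (G.place X k i k').toReal *
        (4 * ((r : ℝ) ^ p)⁻¹ - M.excess p r X.1 k i) := by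
        refine Finset.sum_le_sum fun k' _ => ?_
        by_cases h0 : G.place X k i k' = 0
        · simp [h0]
        have hgreedy := G.greedy X k i hX hk k' ((G.place X k i).mem_support_iff k' |>.mpr h0)
        -- Customers are conserved, so the new counts form a state, and it is the only one
        -- contributing to the inner sum.
        let Z : M.State r := ⟨M.arrive (M.depart X.1 k i) k' i, fun j => by
          rw [sum_arrive hgreedy.1, sum_depart hX hk, X.2 j]; ring⟩
        refine mul_le_mul_of_nonneg_left ?_ ENNReal.toReal_nonneg
        rw [Finset.sum_eq_single Z]
        · rw [if_pos rfl]
          exact cost_migration_le p r hX hk hgreedy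
        · exact fun Y _ hY => if_neg fun h => hY (Subtype.ext h)
        · exact fun h => absurd (Finset.mem_univ Z) h
    _ = _ := by rw [← Finset.sum_mul, G.sum_place, one_mul]

theorem drift_le {a b : ℝ} (ha : ∀ i, a ≤ M.μ i) (hb : ∀ i, M.μ i ≤ b) (X : M.State r) :
    ∑ Y, G.rate X Y * (M.cost p r Y.1 - M.cost p r X.1) ≤
      4 * b * (r * ((r : ℝ) ^ p)⁻¹) - a * M.totalExcess p r X.1 := by
  rw [G.sum_rate_mul X fun Y => M.cost p r Y.1 - M.cost p r X.1]
  have hε : (0 : ℝ) ≤ ((r : ℝ) ^ p)⁻¹ := by positivity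
  calc _ ≤ ∑ k : M.Config, ∑ i : Fin I, (4 * b * ((r : ℝ) ^ p)⁻¹ * ((k.1 i : ℝ) * X.1 k) -
        a * ((k.1 i : ℝ) * X.1 k * M.excess p r X.1 k i)) := by
        refine Finset.sum_le_sum fun k _ => Finset.sum_le_sum fun i _ => ?_
        rcases Nat.eq_zero_or_pos (X.1 k) with hX | hX
        · simp [hX]
        rcases Nat.eq_zero_or_pos (k.1 i) with hk | hk
        · simp [hk]
        have hμ := M.μ_pos i
        refine (mul_le_mul_of_nonneg_left (G.sum_place_mul_le X hX hk) (by positivity)).trans ?_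
        have h1 : (0 : ℝ) ≤ (k.1 i : ℝ) * X.1 k := by positivity
        have h2 : M.μ i * (4 * ((r : ℝ) ^ p)⁻¹ - M.excess p r X.1 k i) ≤
            4 * b * ((r : ℝ) ^ p)⁻¹ - a * M.excess p r X.1 k i := by
          have h3 := mul_le_mul_of_nonneg_right (hb i) hε
          have h4 := mul_le_mul_of_nonneg_right (ha i) (excess_nonneg (p := p) (r := r) X.1 k i)
          linarith
        have h5 := mul_le_mul_of_nonneg_left h2 h1
        linarith
    _ = _ := by
        simp only [Finset.sum_sub_distrib, ← Finset.mul_sum, sum_customers, totalExcess]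
        ring

/-! ### Stationarity and the mean total excess -/

variable {G}

/-- Differentiate the invariance identity at time `0`; it is known only for `t ≥ 0`, so the
derivative is taken within `Set.Ici 0`. -/
theorem IsStationary.sum_generator {ν : Measure (M.State r)} (hν : G.IsStationary ν)
    (Y : M.State r) : ∑ X, ν.real {X} * G.generator X Y = 0 := by
  let _ : NormedRing (Matrix (M.State r) (M.State r) ℝ) := Matrix.linftyOpNormedRing
  let _ : NormedAlgebra ℝ (Matrix (M.State r) (M.State r) ℝ) := Matrix.linftyOpNormedAlgebra
  have h1 := hasDerivAt_exp_smul_const (𝕂 := ℝ) G.generator (0 : ℝ)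
  rw [zero_smul, NormedSpace.exp_zero, one_mul] at h1
  let φ : Matrix (M.State r) (M.State r) ℝ →ₗ[ℝ] ℝ :=
    { toFun := fun A => ∑ X, ν.real {X} * A X Y
      map_add' := fun A B => by simp [mul_add, Finset.sum_add_distrib]
      map_smul' := fun c A => by
        simp only [Matrix.smul_apply, smul_eq_mul, Finset.mul_sum, RingHom.id_apply]
        exact Finset.sum_congr rfl fun X _ => by ring }
  have h2 : HasDerivAt (fun t : ℝ => φ (NormedSpace.exp (t • G.generator))) (φ G.generator) 0 :=
    (LinearMap.toContinuousLinearMap φ).hasFDerivAt.comp_hasDerivAt (0 : ℝ) h1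
  have h3 : HasDerivWithinAt (fun t : ℝ => φ (NormedSpace.exp (t • G.generator))) 0
      (Set.Ici 0) 0 :=
    (hasDerivWithinAt_const (0 : ℝ) (Set.Ici 0) (ν.real {Y})).congr
      (fun t ht => hν.2 t ht Y) (hν.2 0 le_rfl Y)
  exact (uniqueDiffOn_Ici (0 : ℝ) 0 Set.self_mem_Ici).eq_deriv _ h2.hasDerivWithinAt h3

theorem IsStationary.sum_rate_sub {ν : Measure (M.State r)} (hν : G.IsStationary ν)
    (f : M.State r → ℝ) :
    ∑ X, ν.real {X} * ∑ Y, G.rate X Y * (f Y - f X) = 0 := by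
  have h1 : ∀ X, ∑ Y, G.rate X Y * (f Y - f X) = ∑ Y, G.generator X Y * f Y := by
    intro X
    simp only [generator, Matrix.sub_apply, Matrix.of_apply, sub_mul, mul_sub,
      Finset.sum_sub_distrib, Matrix.diagonal_apply, ite_mul, zero_mul, Finset.sum_ite_eq,
      Finset.mem_univ, if_true, Finset.sum_mul]
  simp only [h1, Finset.mul_sum, ← mul_assoc]
  rw [Finset.sum_comm]
  simp only [← Finset.sum_mul, hν.sum_generator, zero_mul, Finset.sum_const_zero]

theorem IsStationary.mul_sum_totalExcess_le {ν : Measure (M.State r)} (hν : G.IsStationary ν)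
    {a b : ℝ} (ha : ∀ i, a ≤ M.μ i) (hb : ∀ i, M.μ i ≤ b) :
    a * ∑ X, ν.real {X} * M.totalExcess p r X.1 ≤ 4 * b * (r * ((r : ℝ) ^ p)⁻¹) := by
  have := hν.1
  have hsum : ∑ X, ν.real {X} = 1 := by
    rw [sum_measureReal_singleton]
    simp
  have h1 := hν.sum_rate_sub fun X => M.cost p r X.1
  have h2 : ∑ X, ν.real {X} * ∑ Y, G.rate X Y * (M.cost p r Y.1 - M.cost p r X.1) ≤
      ∑ X, ν.real {X} *
        (4 * b * (r * ((r : ℝ) ^ p)⁻¹) - a * M.totalExcess p r X.1) :=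
    Finset.sum_le_sum fun X _ =>
      mul_le_mul_of_nonneg_left (G.drift_le ha hb X) measureReal_nonneg
  rw [h1] at h2
  simp only [mul_sub, Finset.sum_sub_distrib, ← Finset.sum_mul, hsum, one_mul] at h2
  have h3 : ∑ X, ν.real {X} * (a * M.totalExcess p r X.1) =
      a * ∑ X, ν.real {X} * M.totalExcess p r X.1 := by
    rw [Finset.mul_sum]
    exact Finset.sum_congr rfl fun X _ => by ring
  linarith

end GSS

theorem exists_service_rate_bounds (M : PackingModel I) :
    ∃ a b : ℝ, 0 < a ∧ (∀ i, a ≤ M.μ i) ∧ ∀ i, M.μ i ≤ b := by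
  rcases isEmpty_or_nonempty (Fin I) with h | h
  · exact ⟨1, 1, one_pos, fun i => h.elim i, fun i => h.elim i⟩
  · obtain ⟨i, hi⟩ := Finite.exists_min M.μ
    obtain ⟨j, hj⟩ := Finite.exists_max M.μ
    exact ⟨M.μ i, M.μ j, M.μ_pos i, hi, hj⟩

theorem totalExcess_nonneg (X : M.Config → ℕ) : 0 ≤ M.totalExcess p r X :=
  Finset.sum_nonneg fun k _ => Finset.sum_nonneg fun i _ =>
    mul_nonneg (by positivity) (excess_nonneg X k i)

variable (M p) in
/-- In a stationary regime the total excess rarely exceeds a multiple of `r ^ p`. -/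
theorem exists_measureReal_totalExcess_le {c : ℝ} (hc : 0 < c) :
    ∃ K : ℝ, ∀ r : ℕ, 0 < r → ∀ (G : M.GSS p r) (ν : Measure (M.State r)), G.IsStationary ν →
      ν.real {X | c * (r : ℝ) ^ p ≤ M.totalExcess p r X.1} ≤ K * (r : ℝ) ^ (1 - 2 * p) := by
  obtain ⟨a, b, ha0, ha, hb⟩ := M.exists_service_rate_bounds
  refine ⟨4 * b / (a * c), fun r hr G ν hν => ?_⟩
  have hr' : (0 : ℝ) < r := Nat.cast_pos.mpr hr
  have hrp : 0 < (r : ℝ) ^ p := Real.rpow_pos_of_pos hr' p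
  have := hν.1
  have hint : Integrable (fun X : M.State r => M.totalExcess p r X.1) ν := .of_finite
  -- Markov's inequality.
  have h1 := mul_meas_ge_le_integral_of_nonneg
    (ae_of_all ν fun X : M.State r => totalExcess_nonneg (p := p) (r := r) X.1) hint
    (c * (r : ℝ) ^ p)
  rw [integral_fintype hint] at h1
  have h2 := hν.mul_sum_totalExcess_le ha hb
  have h3 := (mul_le_mul_of_nonneg_left h1 ha0.le).trans h2
  have h4 : (r : ℝ) ^ (1 - 2 * p) = r * ((r : ℝ) ^ p)⁻¹ * ((r : ℝ) ^ p)⁻¹ := by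
    rw [Real.rpow_sub hr', Real.rpow_one, two_mul, Real.rpow_add hr']
    field_simp
  rw [h4]
  have h5 : 4 * b / (a * c) * (r * ((r : ℝ) ^ p)⁻¹ * ((r : ℝ) ^ p)⁻¹) =
      4 * b * (r * ((r : ℝ) ^ p)⁻¹) / (a * (c * (r : ℝ) ^ p)) := by
    field_simp
  rw [h5, le_div_iff₀ (by positivity)]
  linarith

end PackingModel

/-! ### Convergence in distribution to zero -/

section Convergence

variable {ι : Type*} {l : Filter ι} {Ω : ι → Type*} [∀ i, MeasurableSpace (Ω i)]
  {P : (i : ι) → Measure (Ω i)} [∀ i, IsProbabilityMeasure (P i)] {d : (i : ι) → Ω i → ℝ}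
  {a : ι → ℝ}

theorem tendsto_measure_le_one (hd : ∀ i, Measurable (d i))
    (h : Tendsto (fun i => (P i).real {ω | a i < d i ω}) l (𝓝 0)) :
    Tendsto (fun i => P i {ω | d i ω ≤ a i}) l (𝓝 1) := by
  have h1 : ∀ i, P i {ω | d i ω ≤ a i} = ENNReal.ofReal (1 - (P i).real {ω | a i < d i ω}) := by
    intro i
    rw [← probReal_compl_eq_one_sub (measurableSet_lt measurable_const (hd i)),
      ofReal_measureReal]
    congr 1
    ext ω
    simp
  simp only [h1]
  have h2 := ENNReal.tendsto_ofReal (h.const_sub 1)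
  simpa using h2

/-- For a bounded continuous test function, continuity at `0` controls the event `d ≤ a`, and
boundedness controls its complement, whose probability vanishes. -/
theorem tendstoInDistribution_zero (hd : ∀ i, Measurable (d i)) (hd0 : ∀ i ω, 0 ≤ d i ω)
    (ha : Tendsto a l (𝓝 0)) (h : Tendsto (fun i => (P i).real {ω | a i < d i ω}) l (𝓝 0)) :
    TendstoInDistribution d l (fun _ : Unit => (0 : ℝ)) P (Measure.dirac ()) where
  forall_aemeasurable := fun i => (hd i).aemeasurable
  aemeasurable_limit := aemeasurable_const
  tendsto := by
    refine ProbabilityMeasure.tendsto_iff_forall_integral_tendsto.mpr fun f => ?_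
    have hlim : ∫ x, f x ∂((Measure.dirac ()).map fun _ : Unit => (0 : ℝ)) = f 0 := by
      simp
    have hmap : ∀ i, ∫ x, f x ∂((P i).map (d i)) = ∫ ω, f (d i ω) ∂(P i) := fun i =>
      integral_map (hd i).aemeasurable f.continuous.aestronglyMeasurable
    change Tendsto (fun i => ∫ x, f x ∂((P i).map (d i))) l
      (𝓝 (∫ x, f x ∂((Measure.dirac ()).map fun _ : Unit => (0 : ℝ))))
    simp only [hlim, hmap]
    rw [Metric.tendsto_nhds]
    intro ε hε
    obtain ⟨δ, hδ, hfδ⟩ := Metric.continuousAt_iff.mp f.continuous.continuousAt (ε / 2) (half_pos hε)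
    have hN : (0 : ℝ) < 2 * ‖f‖ + 1 := by positivity
    filter_upwards [ha.eventually (gt_mem_nhds hδ),
      h.eventually (gt_mem_nhds (show (0 : ℝ) < ε / 2 / (2 * ‖f‖ + 1) by positivity))]
      with i hai hPi
    have hmeas : MeasurableSet {ω | a i < d i ω} := measurableSet_lt measurable_const (hd i)
    have hfint : Integrable (fun ω => f (d i ω)) (P i) :=
      Integrable.of_bound (f.continuous.measurable.comp (hd i)).aestronglyMeasurable ‖f‖
        (ae_of_all _ fun ω => f.norm_coe_le_norm _)
    have hbound : ∀ ω, ‖f (d i ω) - f 0‖ ≤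
        ε / 2 + {ω | a i < d i ω}.indicator (fun _ => 2 * ‖f‖ + 1) ω := by
      intro ω
      by_cases hω : a i < d i ω
      · rw [Set.indicator_of_mem (show ω ∈ {ω | a i < d i ω} from hω)]
        have h1 := f.norm_coe_le_norm (d i ω)
        have h2 := f.norm_coe_le_norm 0
        have h3 := norm_sub_le (f (d i ω)) (f 0)
        linarith
      · rw [Set.indicator_of_notMem (show ω ∉ {ω | a i < d i ω} from hω), add_zero]
        have h1 : dist (d i ω) 0 < δ := by
          rw [Real.dist_eq, sub_zero, abs_of_nonneg (hd0 i ω)]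
          linarith
        exact (hfδ h1).le
    rw [dist_eq_norm]
    calc ‖∫ ω, f (d i ω) ∂(P i) - f 0‖ = ‖∫ ω, (f (d i ω) - f 0) ∂(P i)‖ := by
          rw [integral_sub hfint (integrable_const _)]; simp
      _ ≤ ∫ ω, (ε / 2 + {ω | a i < d i ω}.indicator (fun _ => 2 * ‖f‖ + 1) ω) ∂(P i) :=
          norm_integral_le_of_norm_le
            ((integrable_const _).add ((integrable_const _).indicator hmeas))
            (ae_of_all _ hbound)
      _ = ε / 2 + (P i).real {ω | a i < d i ω} * (2 * ‖f‖ + 1) := by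
          rw [integral_add (integrable_const _) ((integrable_const _).indicator hmeas),
            integral_indicator_const _ hmeas]
          simp
      _ < ε / 2 + ε / 2 := by
          gcongr
          rwa [lt_div_iff₀ hN] at hPi
      _ = ε := add_halves ε

end Convergence

theorem mainTheorem1 {I : ℕ} (M : PackingModel I) (p : ℝ) (hp : p ∈ Set.Ioo (1 / 2 : ℝ) 1) :
    ∃ C : ℝ, 0 < C ∧
      ∀ (G : (r : M.Size) → M.GSS p r.1)
        (Ω : M.Size → Type*) [∀ r, MeasurableSpace (Ω r)]
        (P : (r : M.Size) → Measure (Ω r)) [∀ r, IsProbabilityMeasure (P r)]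
        (X : (r : M.Size) → Ω r → M.State r.1),
        (∀ r, Measurable (X r)) →
        (∀ r, (G r).IsStationary ((P r).map (X r))) →
        Tendsto
            (fun r : M.Size =>
              P r {ω | Metric.infDist (M.fluid (X r ω)) M.lpOptimal ≤ C * (r.1 : ℝ) ^ (p - 1)})
            (comap (fun r : M.Size => r.1) atTop) (𝓝 1) ∧
          TendstoInDistribution
            (fun (r : M.Size) ω => Metric.infDist (M.fluid (X r ω)) M.lpOptimal)
            (comap (fun r : M.Size => r.1) atTop) (fun _ : Unit => (0 : ℝ)) P
            (Measure.dirac ()) := by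
  -- `C`, `c` and `K` are fixed before the policies and stationary laws, which gives the uniformity.
  obtain ⟨C, c, hC, hc, hdist⟩ := PackingModel.exists_infDist_fluid_le M p
  obtain ⟨K, hK⟩ := PackingModel.exists_measureReal_totalExcess_le M p hc
  refine ⟨C, hC, ?_⟩
  intro G Ω _ P _ X hX hstat
  have hmeas : ∀ r : M.Size, Measurable fun ω => Metric.infDist (M.fluid (X r ω)) M.lpOptimal :=
    fun r => (measurable_from_top
      (f := fun Y : M.State r.1 => Metric.infDist (M.fluid Y) M.lpOptimal)).comp (hX r)
  have hr : Tendsto (fun r : M.Size => (r.1 : ℝ)) (comap (fun r : M.Size => r.1) atTop) atTop :=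
    tendsto_natCast_atTop_atTop.comp tendsto_comap
  have ha : Tendsto (fun r : M.Size => C * (r.1 : ℝ) ^ (p - 1))
      (comap (fun r : M.Size => r.1) atTop) (𝓝 0) := by
    have h1 := (tendsto_rpow_neg_atTop (show 0 < 1 - p by linarith [hp.2])).comp hr
    simpa [Function.comp_def] using h1.const_mul C
  have hb : Tendsto (fun r : M.Size => K * (r.1 : ℝ) ^ (1 - 2 * p))
      (comap (fun r : M.Size => r.1) atTop) (𝓝 0) := by
    have h1 := (tendsto_rpow_neg_atTop (show 0 < 2 * p - 1 by linarith [hp.1])).comp hr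
    simpa [Function.comp_def] using h1.const_mul K
  have hP : Tendsto (fun r : M.Size => (P r).real {ω | C * (r.1 : ℝ) ^ (p - 1) <
      Metric.infDist (M.fluid (X r ω)) M.lpOptimal})
      (comap (fun r : M.Size => r.1) atTop) (𝓝 0) := by
    refine tendsto_of_tendsto_of_tendsto_of_le_of_le' tendsto_const_nhds hb
      (Eventually.of_forall fun r => measureReal_nonneg) ?_
    filter_upwards [tendsto_comap.eventually (eventually_gt_atTop 0)] with r hr0
    refine le_trans ?_ (hK r.1 hr0 (G r) _ (hstat r))
    rw [map_measureReal_apply (hX r) MeasurableSpace.measurableSet_top]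
    refine measureReal_mono fun ω hω => ?_
    by_contra hcon
    exact absurd (hdist r.1 hr0 (X r ω) (not_le.mp hcon).le) (not_le.mpr hω)
  exact ⟨tendsto_measure_le_one hmeas hP,
    tendstoInDistribution_zero hmeas (fun _ _ => Metric.infDist_nonneg) ha hP⟩
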